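/- **Theorem (Reconstruction of distance-hereditary graphs).** A finite simple graph $G$ is *distance-hereditary* if for every connected induced subgraph $H$ of $G$ and all nodes $u,v$ of $H$ one has $d_H(u,v)=d_G(u,v)$. In the *number-in-hand (NIH) network model* the input is a simple undirected graph $G$ on the node set $[k]$; each player $v\in[k]$ holds only the characteristic vector $\nu_v\in\{0,1\}^k$ of its neighborhood in $G$. In a *quantum simultaneous-message-passing protocol* each player sends one quantum message, a state of some number of qubits that depends only on the player and on its own input (there is no shared randomness and no shared entanglement), to a referee who has no input, and the referee produces an output by measuring the messages jointly. The *communication cost* is the total number of qubits sent. There is a constant $C$ such that for every $k$ there is a quantum simultaneous-message-passing protocol for $k$ players in the NIH network model, with communication cost at most $C\,k\log^2 k$, such that on every input graph $G$ on $[k]$ the following holds with probability at least $2/3$: the referee outputs $G$ (all of its edges) if $G$ is distance-hereditary, and rejects if $G$ is not distance-hereditary. -/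

import Mathlib

open scoped Matrix ComplexOrder

/-- The computational basis of a register of `q` qubits: the `2 ^ q` bit strings of length `q`. -/
abbrev QubitBasis (q : ℕ) : Type := Fin q → Bool

/-- A (pure) state of a register whose computational basis is `B`: a unit vector of `ℂ ^ B`. -/
structure PureState (B : Type) [Fintype B] where
  amp : B → ℂ
  norm_one : ∑ b, ‖amp b‖ ^ 2 = 1

/-- A quantum measurement (POVM) with outcomes in `O` on a register with basis `B`:
positive semidefinite matrices, one for each outcome, that sum to the identity. -/
structure Measurement (B O : Type) [Fintype B] [DecidableEq B] [Fintype O] where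
  effect : O → Matrix B B ℂ
  posSemidef : ∀ o, (effect o).PosSemidef
  sum_effect : ∑ o, effect o = 1

/-- Born's rule: the probability `⟨ψ| E_o |ψ⟩` of the outcome `o` when the vector `ψ` is
measured. -/
noncomputable def Measurement.prob {B O : Type} [Fintype B] [DecidableEq B] [Fintype O]
    (M : Measurement B O) (ψ : B → ℂ) (o : O) : ℝ :=
  (star ψ ⬝ᵥ (M.effect o *ᵥ ψ)).re

/-- A quantum simultaneous-message-passing protocol with `k` players, inputs from `X` and outputs
in `O`, without shared randomness or entanglement. Player `v` sends a message of `qubits v` qubits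
whose state depends only on the player and on its own input. The referee, who has no input,
measures all the messages jointly and outputs the outcome. -/
structure QuantumSMP (k : ℕ) (X O : Type) [Fintype O] where
  qubits : Fin k → ℕ
  message : (v : Fin k) → X → PureState (QubitBasis (qubits v))
  referee : Measurement ((v : Fin k) → QubitBasis (qubits v)) O

namespace QuantumSMP

variable {k : ℕ} {X O : Type} [Fintype O]

/-- The communication cost: the total number of qubits sent to the referee. -/
def cost (P : QuantumSMP k X O) : ℕ := ∑ v, P.qubits v

/-- The joint state that the referee receives on the inputs `x`: the tensor product of the players'
messages. -/
noncomputable def jointState (P : QuantumSMP k X O) (x : Fin k → X) :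
    ((v : Fin k) → QubitBasis (P.qubits v)) → ℂ :=
  fun b => ∏ v, (P.message v (x v)).amp (b v)

/-- The probability that the referee outputs `o` on the inputs `x`. -/
noncomputable def outputProb (P : QuantumSMP k X O) (x : Fin k → X) (o : O) : ℝ :=
  P.referee.prob (P.jointState x) o

end QuantumSMP

open Classical in
/-- The neighborhood vector of `v` in `{0,1} ^ k`: the input of player `v` in the number-in-hand
network model. -/
noncomputable def neighborhoodVector {k : ℕ} (G : SimpleGraph (Fin k)) (v : Fin k) :
    Fin k → ZMod 2 :=
  fun u => if G.Adj v u then 1 else 0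

/-- `P` solves the graph problem `f` with bounded error in the number-in-hand network model: on
every graph `G` on the `k` players, where player `v` holds the neighborhood vector of `v`, the
referee outputs `f G` with probability at least `2 / 3`. -/
def QuantumSMP.SolvesNIH {k : ℕ} {O : Type} [Fintype O]
    (P : QuantumSMP k (Fin k → ZMod 2) O) (f : SimpleGraph (Fin k) → O) : Prop :=
  ∀ G : SimpleGraph (Fin k), 2 / 3 ≤ P.outputProb (neighborhoodVector G) (f G)

/-- A graph (connected or not) is distance-hereditary if distances in every connected induced
subgraph agree with distances in the graph. -/
def IsDistanceHereditary {V : Type*} (G : SimpleGraph V) : Prop :=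
  ∀ S : Set V, (G.induce S).Connected →
    ∀ u v : S, (G.induce S).dist u v = G.dist (u : V) (v : V)

open Classical in
/-- The reconstruction task for distance-hereditary graphs: output the graph itself if it is
distance-hereditary, and reject (`none`) otherwise. -/
noncomputable def reconstructDistanceHereditary {k : ℕ} (G : SimpleGraph (Fin k)) :
    Option (SimpleGraph (Fin k)) :=
  if IsDistanceHereditary G then some G else none

/-! Each player sends a quantum fingerprint of its neighborhood vector, so a graph becomes a product
state. Two graphs on which exactly `d` players see different neighborhoods have overlap at most `δ ^
d`, where `δ` is polynomially small in `k` when fingerprints have `O(log k)` qubits.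

Few distance-hereditary graphs are close to a given graph `H`. If `G` differs from `H` only in the
neighborhoods of the players in `D`, then `G` is determined by `H` and the edges of `G` inside `D`.
Distance-hereditary graphs leave at most `(4 k²) ^ |D|` patterns there (`card_image_restrictTo_le`),
because they are pruned vertex by vertex: there is always a vertex of degree at most one or a pair
of twins (`IsDistanceHereditary.exists_prunable`). Summing over nonempty `D`, the total overlap is
at most `(1 + 4 k² δ) ^ k - 1 ≤ 1/3`.

This holds for every `H`, distance-hereditary or not. Hence the states of the distance-hereditary
graphs are almost orthogonal, and every other graph state is almost orthogonal to all of them;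
scaled rank-one projections, completed by a rejecting effect, succeed (`exists_measurement`). The
cost is `O(k log k)`, so the second logarithm in the bound is slack. -/

namespace SimpleGraph

/-! ### Graph distance -/

variable {V W : Type*} {G : SimpleGraph V} {H : SimpleGraph W}

lemma Reachable.dist_map_le (f : H →g G) {a b : W} (h : H.Reachable a b) :
    G.dist (f a) (f b) ≤ H.dist a b := by
  obtain ⟨p, hp⟩ := h.exists_walk_length_eq_dist
  rw [← hp, ← Walk.length_map f p]
  exact dist_le _

/-- A vertex at distance `n + 1` from `r` has a neighbour at distance `n` from `r`. -/
lemma exists_adj_dist_eq {r x : V} {n : ℕ} (h : G.dist r x = n + 1) :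
    ∃ s, G.Adj s x ∧ G.dist r s = n ∧ G.Reachable r s := by
  have hr : G.Reachable r x := Reachable.of_dist_ne_zero (by omega)
  obtain ⟨p, hp⟩ := hr.symm.exists_walk_length_eq_dist
  rw [dist_comm, h] at hp
  cases p with
  | nil => simp at hp
  | cons hadj q =>
    rename_i s
    refine ⟨s, hadj.symm, ?_, q.reachable.symm⟩
    have h1 : G.dist r s ≤ n := by
      rw [dist_comm]; exact (dist_le q).trans (by simpa using hp.le)
    rcases hadj.diff_dist_adj (u := r) with h2 | h2 | h2 <;> omega

lemma dist_eq_two {r c x : V} (hne : r ≠ x) (hnadj : ¬ G.Adj r x) (h1 : G.Adj r c)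
    (h2 : G.Adj c x) : G.dist r x = 2 := by
  have hr : G.Reachable r x := h1.reachable.trans h2.reachable
  have h3 := hr.one_lt_dist_of_ne_of_not_adj hne hnadj
  have h4 := dist_le (Walk.cons h1 (Walk.cons h2 Walk.nil))
  simp only [Walk.length_cons, Walk.length_nil] at h4
  omega

end SimpleGraph

/-! ### Distance levels in distance-hereditary graphs -/

namespace IsDistanceHereditary

open SimpleGraph Relation

variable {V W : Type*} {G : SimpleGraph V} {H : SimpleGraph W}

/-- Distances within the components of an induced subgraph are those of the whole graph. -/
lemma dist_embedding (hG : IsDistanceHereditary G) (f : H ↪g G) {a b : W}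
    (hab : H.Reachable a b) : H.dist a b = G.dist (f a) (f b) := by
  -- The defining property needs a connected subgraph, so only the image of the component of `a` is
  -- used. Mapping it back into `H` gives the nontrivial inequality.
  let S : Set V := f '' {c | H.Reachable a c}
  have hmem : ∀ c, H.Reachable a c → f c ∈ S := fun c hc => ⟨c, hc, rfl⟩
  have hreach : ∀ c (hc : H.Reachable a c),
      (G.induce S).Reachable ⟨f a, hmem a (Reachable.refl a)⟩ ⟨f c, hmem c hc⟩ := by
    intro c hc
    have hc' := (reachable_iff_reflTransGen a c).1 hc
    induction hc' with
    | refl => exact Reachable.refl _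
    | @tail c d hac hcd ih =>
      have hac' := (reachable_iff_reflTransGen a c).2 hac
      refine (ih hac').trans (Adj.reachable ?_)
      simpa using hcd
  have hconn : (G.induce S).Connected := by
    rw [connected_iff_exists_forall_reachable]
    refine ⟨⟨f a, hmem a (Reachable.refl a)⟩, ?_⟩
    rintro ⟨_, c, hc, rfl⟩
    exact hreach c hc
  have hS := hG S hconn ⟨f a, hmem a (Reachable.refl a)⟩ ⟨f b, hmem b hab⟩
  refine le_antisymm ?_ (hab.dist_map_le f.toHom)
  rw [← hS]
  let g : G.induce S →g H :=
    { toFun := fun x => x.2.choose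
      map_rel' := by
        intro x y hxy
        have hx := x.2.choose_spec.2
        have hy := y.2.choose_spec.2
        rw [← f.map_adj_iff, hx, hy]
        exact hxy }
  have hg : ∀ c (hc : f c ∈ S), g ⟨f c, hc⟩ = c := fun c hc => f.injective hc.choose_spec.2
  have := (hreach b hab).dist_map_le g
  rwa [hg, hg] at this

lemma induce (hG : IsDistanceHereditary G) (S : Set V) : IsDistanceHereditary (G.induce S) := by
  intro T hT u v
  have h1 := hG.dist_embedding ((Embedding.induce S).comp (Embedding.induce T)) (hT u v)
  have h2 := hG.dist_embedding (Embedding.induce S)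
    ((hT u v).map (Embedding.induce (G := G.induce S) T).toHom)
  rw [h1]
  exact h2.symm

/-- Two vertices at distance `i + 1` from a root that are joined by a path at distance more than
`i` have the same neighbours at distance `i`. -/
lemma adj_of_reflTransGen (hG : IsDistanceHereditary G) {r t x y : V} {i : ℕ}
    (hrt : G.Reachable r t) (ht : G.dist r t = i) (htx : G.Adj t x)
    (hx : G.dist r x = i + 1) (hy : G.dist r y = i + 1)
    (hxy : ReflTransGen (fun a b => G.Adj a b ∧ i < G.dist r b) x y) : G.Adj t y := by
  -- Level `i` is deleted except for `t`. The vertex `y` is still reachable from `r`, through `t`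
  -- and `x`, so its distance stays `i + 1`, and its predecessor on a geodesic can only be `t`.
  let S : Set V := {z | z = t ∨ G.dist r z ≠ i}
  have hrS : r ∈ S := by
    by_cases hi : i = 0
    · subst hi; left; exact hrt.dist_eq_zero_iff.1 ht
    · right; simpa using Ne.symm hi
  have hlow : ∀ n, n < i → ∀ z, G.Reachable r z → G.dist r z = n →
      ∃ hz : z ∈ S, (G.induce S).Reachable ⟨r, hrS⟩ ⟨z, hz⟩ := by
    intro n
    induction n with
    | zero =>
      intro _ z hz h0
      obtain rfl := hz.dist_eq_zero_iff.1 h0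
      exact ⟨hrS, Reachable.refl _⟩
    | succ n ih =>
      intro hn z hz h0
      obtain ⟨s, hsz, hs, hrs⟩ := exists_adj_dist_eq h0
      obtain ⟨hs', h⟩ := ih (by omega) s hrs hs
      have hz' : z ∈ S := Or.inr (by omega)
      exact ⟨hz', h.trans (Adj.reachable (by simpa using hsz))⟩
  have htS : t ∈ S := Or.inl rfl
  have hrt' : (G.induce S).Reachable ⟨r, hrS⟩ ⟨t, htS⟩ := by
    cases i with
    | zero =>
      obtain rfl := hrt.dist_eq_zero_iff.1 ht
      exact Reachable.refl _
    | succ n =>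
      obtain ⟨s, hst, hs, hrs⟩ := exists_adj_dist_eq ht
      obtain ⟨hs', h⟩ := hlow n (by omega) s hrs hs
      exact h.trans (Adj.reachable (by simpa using hst))
  have hry : ∃ hyS : y ∈ S, (G.induce S).Reachable ⟨r, hrS⟩ ⟨y, hyS⟩ := by
    clear hy
    induction hxy with
    | refl =>
      exact ⟨Or.inr (by omega), hrt'.trans (Adj.reachable (by simpa using htx))⟩
    | tail _ hbc ih =>
      obtain ⟨hb, h⟩ := ih
      exact ⟨Or.inr (by have := hbc.2; omega), h.trans (Adj.reachable (by simpa using hbc.1))⟩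
  obtain ⟨hyS, hry⟩ := hry
  have hd := hG.dist_embedding (Embedding.induce S) hry
  obtain ⟨s, hsy, hs, hrs⟩ := exists_adj_dist_eq (hd.trans hy)
  have hd' := hG.dist_embedding (Embedding.induce S) hrs
  have hsy' : G.Adj s y := by simpa using hsy
  rcases s.2 with h | h
  · rwa [h] at hsy'
  · exact absurd (hd'.symm.trans hs) h

/-- Two vertices at distance two from `r` that are joined by a path of length at most two avoiding
the closed neighbourhood of `r` have the same neighbours among the neighbours of `r`. -/
lemma adj_of_common_neighbor (hG : IsDistanceHereditary G) {r c d x s y : V}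
    (hrx : r ≠ x) (hry : r ≠ y) (hrx' : ¬ G.Adj r x) (hry' : ¬ G.Adj r y)
    (hrs : r ≠ s) (hrs' : ¬ G.Adj r s)
    (hc : G.Adj r c) (hcx : G.Adj c x) (hd : G.Adj r d) (hdy : G.Adj d y)
    (hxs : G.Adj x s) (hsy : G.Adj s y) : G.Adj c y := by
  have h1 := dist_eq_two hrx hrx' hc hcx
  have h2 := dist_eq_two hry hry' hd hdy
  have h3 := (hc.reachable.trans (hcx.reachable.trans
    hxs.reachable)).one_lt_dist_of_ne_of_not_adj hrs hrs'
  exact hG.adj_of_reflTransGen hc.reachable (dist_eq_one_iff_adj.2 hc) hcx h1 h2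
    ((ReflTransGen.single ⟨hxs, h3⟩).tail ⟨hsy, by omega⟩)

lemma adj_of_common_neighbor_of_adj (hG : IsDistanceHereditary G) {r c d x y : V}
    (hrx : r ≠ x) (hry : r ≠ y) (hrx' : ¬ G.Adj r x) (hry' : ¬ G.Adj r y)
    (hc : G.Adj r c) (hcx : G.Adj c x) (hd : G.Adj r d) (hdy : G.Adj d y)
    (hxy : G.Adj x y) : G.Adj c y :=
  hG.adj_of_reflTransGen hc.reachable (dist_eq_one_iff_adj.2 hc) hcx (dist_eq_two hrx hrx' hc hcx)
    (dist_eq_two hry hry' hd hdy)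
    (ReflTransGen.single ⟨hxy, by rw [dist_eq_two hry hry' hd hdy]; omega⟩)

end IsDistanceHereditary

/-! ### Graphs without induced four-vertex paths: Seinsche's theorem and twins -/

namespace SimpleGraph

variable {V : Type*}

/-- No four vertices of `S` induce a path. -/
def IsPathFourFree (G : SimpleGraph V) (S : Finset V) : Prop :=
  ∀ a ∈ S, ∀ b ∈ S, ∀ c ∈ S, ∀ d ∈ S, G.Adj a b → G.Adj b c → G.Adj c d → ¬ G.Adj a c →
    ¬ G.Adj b d → a ≠ c → b ≠ d → a ≠ d → G.Adj a d

lemma IsPathFourFree.mono {G : SimpleGraph V} {S T : Finset V} (h : G.IsPathFourFree T)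
    (hST : S ⊆ T) : G.IsPathFourFree S :=
  fun a ha b hb c hc d hd => h a (hST ha) b (hST hb) c (hST hc) d (hST hd)

/-- The four-vertex path is self-complementary: `a b c d` in the complement is `c a d b` in `G`. -/
lemma IsPathFourFree.compl {G : SimpleGraph V} {S : Finset V} (h : G.IsPathFourFree S) :
    Gᶜ.IsPathFourFree S := by
  intro a ha b hb c hc d hd hab hbc hcd hac hbd h1 h2 h3
  have := h c hc a ha d hd b hb
  have := G.adj_comm
  simp only [compl_adj] at *
  grind

variable [DecidableEq V]

/-- The step from `S` to `insert v S` in Seinsche's theorem, when no edge joins `A` and `B`. -/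
lemma IsPathFourFree.exists_split_insert {G : SimpleGraph V} {v : V} {A B : Finset V}
    (h : G.IsPathFourFree (insert v (A ∪ B))) (hv : v ∉ A ∪ B)
    (hB : B.Nonempty) (hAB : ∀ a ∈ A, ∀ b ∈ B, a ≠ b ∧ ¬ G.Adj a b)
    (hy : ∃ y ∈ A, ¬ G.Adj v y) :
    ∃ A' B' : Finset V, insert v (A ∪ B) = A' ∪ B' ∧ A'.Nonempty ∧ B'.Nonempty ∧
      ∀ a ∈ A', ∀ b ∈ B', a ≠ b ∧ ¬ G.Adj a b := by
  classical
  by_cases hz : ∃ z ∈ B, G.Adj v z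
  · obtain ⟨z, hzB, hvz⟩ := hz
    obtain ⟨y, hyA, hvy⟩ := hy
    -- The non-neighbors of `v` in `A` are split off. An edge from such an `a` to a neighbor `b` of
    -- `v` in `A` would make `z v b a` an induced path.
    refine ⟨A.filter (fun a => ¬ G.Adj v a), insert v (A.filter (fun a => G.Adj v a) ∪ B), ?_,
      ⟨y, by simp [hyA, hvy]⟩, ⟨v, by simp⟩, ?_⟩
    · ext w; simp only [Finset.mem_insert, Finset.mem_union, Finset.mem_filter]; tauto
    · intro a ha b hb
      simp only [Finset.mem_insert, Finset.mem_union, Finset.mem_filter] at ha hb hv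
      rcases hb with rfl | hb | hb
      · exact ⟨by rintro rfl; tauto, fun h => ha.2 h.symm⟩
      · refine ⟨by rintro rfl; tauto, fun hab => ?_⟩
        have := h z (by simp [hzB]) v (by simp) b (by simp [hb.1]) a (by simp [ha.1]) hvz.symm
          hb.2 hab.symm (fun h => (hAB b hb.1 z hzB).2 h.symm) ha.2
          (hAB b hb.1 z hzB).1.symm (by rintro rfl; tauto) (hAB a ha.1 z hzB).1.symm
        exact (hAB a ha.1 z hzB).2 this.symm
      · exact hAB a ha.1 b hb
  · push Not at hz
    refine ⟨insert v A, B, by simp, by simp, hB, ?_⟩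
    intro a ha b hb
    rcases Finset.mem_insert.1 ha with rfl | ha
    · exact ⟨by rintro rfl; simp_all, hz b hb⟩
    · exact hAB a ha b hb

/-- Seinsche's theorem: a graph without induced paths on four vertices, or its complement, is
disconnected. -/
lemma IsPathFourFree.exists_split {G : SimpleGraph V} {S : Finset V} (h : G.IsPathFourFree S)
    (hS : 2 ≤ S.card) :
    ∃ A B : Finset V, S = A ∪ B ∧ A.Nonempty ∧ B.Nonempty ∧
      ((∀ a ∈ A, ∀ b ∈ B, a ≠ b ∧ ¬ G.Adj a b) ∨ (∀ a ∈ A, ∀ b ∈ B, a ≠ b ∧ ¬ Gᶜ.Adj a b)) := by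
  induction S using Finset.induction_on with
  | empty => simp at hS
  | insert v S hv ih =>
    have hne : S.Nonempty := by
      rw [Finset.card_insert_of_notMem hv] at hS
      exact Finset.card_pos.1 (by omega)
    by_cases h2 : 2 ≤ S.card
    · obtain ⟨A, B, rfl, hA, hB, hAB⟩ := ih (h.mono (Finset.subset_insert _ _)) h2
      have key : ∀ K : SimpleGraph V, K.IsPathFourFree (insert v (A ∪ B)) →
          (∀ a ∈ A, ∀ b ∈ B, a ≠ b ∧ ¬ K.Adj a b) →
          ∃ A' B' : Finset V, insert v (A ∪ B) = A' ∪ B' ∧ A'.Nonempty ∧ B'.Nonempty ∧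
            ((∀ a ∈ A', ∀ b ∈ B', a ≠ b ∧ ¬ K.Adj a b) ∨
              (∀ a ∈ A', ∀ b ∈ B', a ≠ b ∧ ¬ Kᶜ.Adj a b)) := by
        intro K hK hAB
        by_cases hyA : ∃ y ∈ A, ¬ K.Adj v y
        · obtain ⟨A', B', h1, h2, h3, h4⟩ := hK.exists_split_insert hv hB hAB hyA
          exact ⟨A', B', h1, h2, h3, Or.inl h4⟩
        by_cases hyB : ∃ y ∈ B, ¬ K.Adj v y
        · rw [Finset.union_comm] at hK hv ⊢
          obtain ⟨A', B', h1, h2, h3, h4⟩ := hK.exists_split_insert hv hA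
            (fun a ha b hb => ⟨(hAB b hb a ha).1.symm, fun h => (hAB b hb a ha).2 h.symm⟩) hyB
          exact ⟨A', B', h1, h2, h3, Or.inl h4⟩
        push Not at hyA hyB
        -- Here `v` is adjacent in `K` to everything else, hence isolated in the complement.
        refine ⟨{v}, A ∪ B, Finset.insert_eq _ _, by simp, hne, Or.inr ?_⟩
        intro a ha b hb
        rw [Finset.mem_singleton] at ha
        subst ha
        refine ⟨by rintro rfl; exact hv hb, ?_⟩
        rcases Finset.mem_union.1 hb with hb | hb
        · simp [hyA b hb]
        · simp [hyB b hb]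
      rcases hAB with hAB | hAB
      · exact key G h hAB
      · obtain ⟨A', B', h1, h2, h3, h4⟩ := key Gᶜ h.compl hAB
        rw [compl_compl] at h4
        exact ⟨A', B', h1, h2, h3, h4.symm⟩
    · obtain ⟨w, rfl⟩ := Finset.card_eq_one.1 (show S.card = 1 by
        have := Finset.card_pos.2 hne; omega)
      have hvw : v ≠ w := by simpa using hv
      refine ⟨{v}, {w}, Finset.insert_eq _ _, by simp, by simp, ?_⟩
      by_cases hadj : G.Adj v w <;> simp [hadj, hvw]

/-- A set of at least two vertices without induced paths on four vertices contains twins. -/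
lemma IsPathFourFree.exists_twins {G : SimpleGraph V} {S : Finset V} (h : G.IsPathFourFree S)
    (hS : 2 ≤ S.card) :
    ∃ x ∈ S, ∃ y ∈ S, x ≠ y ∧ ∀ z ∈ S, z ≠ x → z ≠ y → (G.Adj x z ↔ G.Adj y z) := by
  induction S using Finset.strongInduction with
  | H S ih =>
    obtain ⟨A, B, rfl, hA, hB, hAB⟩ := h.exists_split hS
    -- Between `A` and `B` there are either all edges or none, so twins within one part remain twins
    -- in the union.
    have hAB' : ∀ a ∈ A, ∀ a' ∈ A, ∀ b ∈ B, G.Adj a b ↔ G.Adj a' b := by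
      intro a ha a' ha' b hb
      rcases hAB with hAB | hAB
      · simp [hAB a ha b hb, hAB a' ha' b hb]
      · have h1 := hAB a ha b hb
        have h2 := hAB a' ha' b hb
        simp only [compl_adj] at h1 h2
        tauto
    have hBA' : ∀ b ∈ B, ∀ b' ∈ B, ∀ a ∈ A, G.Adj b a ↔ G.Adj b' a := by
      intro b hb b' hb' a ha
      rw [G.adj_comm b, G.adj_comm b']
      rcases hAB with hAB | hAB
      · simp [hAB a ha b hb, hAB a ha b' hb']
      · have h1 := hAB a ha b hb
        have h2 := hAB a ha b' hb'
        simp only [compl_adj] at h1 h2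
        tauto
    have hdisj : Disjoint A B := by
      rw [Finset.disjoint_left]
      intro a ha hb
      rcases hAB with hAB | hAB <;> exact (hAB a ha a hb).1 rfl
    have hcard := Finset.card_union_of_disjoint hdisj
    have hApos := hA.card_pos
    have hBpos := hB.card_pos
    by_cases h2 : 2 ≤ A.card
    · obtain ⟨x, hx, y, hy, hxy, ht⟩ := ih A (by
        refine Finset.ssubset_iff_subset_ne.2 ⟨Finset.subset_union_left, fun he => ?_⟩
        have := congrArg Finset.card he; omega) (h.mono Finset.subset_union_left) h2
      refine ⟨x, Finset.mem_union_left _ hx, y, Finset.mem_union_left _ hy, hxy, ?_⟩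
      intro z hz hzx hzy
      rcases Finset.mem_union.1 hz with hz | hz
      · exact ht z hz hzx hzy
      · exact hAB' x hx y hy z hz
    by_cases h3 : 2 ≤ B.card
    · obtain ⟨x, hx, y, hy, hxy, ht⟩ := ih B (by
        refine Finset.ssubset_iff_subset_ne.2 ⟨Finset.subset_union_right, fun he => ?_⟩
        have := congrArg Finset.card he; omega) (h.mono Finset.subset_union_right) h3
      refine ⟨x, Finset.mem_union_right _ hx, y, Finset.mem_union_right _ hy, hxy, ?_⟩
      intro z hz hzx hzy
      rcases Finset.mem_union.1 hz with hz | hz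
      · exact hBA' x hx y hy z hz
      · exact ht z hz hzx hzy
    obtain ⟨x, rfl⟩ := Finset.card_eq_one.1 (show A.card = 1 by omega)
    obtain ⟨y, rfl⟩ := Finset.card_eq_one.1 (show B.card = 1 by omega)
    refine ⟨x, by simp, y, by simp, by simpa using hdisj, ?_⟩
    intro z hz hzx hzy
    simp at hz
    tauto

end SimpleGraph

/-! ### Pruning: vertices of degree at most one and twins -/

namespace IsDistanceHereditary

open SimpleGraph Relation

variable {V : Type*} {G : SimpleGraph V}

/-- Seen from the end `a` of an induced path `a b c d` with common neighbor `h`, the adjacent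
vertices `c` and `d` are at distance two (via `b` and `h`). They must then share their neighbors at
distance one, but `b` is adjacent only to `c`. -/
lemma isPathFourFree (hG : IsDistanceHereditary G) {M : Finset V} {h : V}
    (hM : ∀ x ∈ M, G.Adj h x) : G.IsPathFourFree M := by
  intro a ha b hb c hc d hd hab hbc hcd hac hbd h1 h2 h3
  by_contra had
  exact hbd (hG.adj_of_common_neighbor_of_adj h1 h3 hac had hab hbc (hM a ha).symm (hM d hd) hcd)

/-- A homogeneous set of at least two vertices with a common neighbour contains twins. -/
lemma exists_twins_of_homogeneous (hG : IsDistanceHereditary G) {M : Finset V} {h : V}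
    (hcard : 2 ≤ M.card) (hM : ∀ x ∈ M, G.Adj h x)
    (hom : ∀ z ∉ M, ∀ x ∈ M, ∀ y ∈ M, G.Adj z x → G.Adj z y) :
    ∃ v w, v ≠ w ∧ ∀ z, z ≠ v → z ≠ w → (G.Adj v z ↔ G.Adj w z) := by
  classical
  obtain ⟨x, hx, y, hy, hxy, ht⟩ := (hG.isPathFourFree hM).exists_twins hcard
  refine ⟨x, y, hxy, fun z hzx hzy => ?_⟩
  by_cases hz : z ∈ M
  · exact ht z hz hzx hzy
  · exact ⟨fun h => (hom z hz x hx y hy h.symm).symm, fun h => (hom z hz y hy x hx h.symm).symm⟩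

variable [Fintype V]

/-- The case of adjacent vertices in the last distance level. -/
lemma exists_twins_of_adj_last_level (hG : IsDistanceHereditary G) {u v w : V} {i : ℕ}
    (hmax : ∀ z, G.dist u z ≤ i + 1) (hv : G.dist u v = i + 1) (hw : G.dist u w = i + 1)
    (hvw : G.Adj v w) :
    ∃ v w, v ≠ w ∧ ∀ z, z ≠ v → z ≠ w → (G.Adj v z ↔ G.Adj w z) := by
  classical
  let rel : V → V → Prop := fun a b => G.Adj a b ∧ i < G.dist u a ∧ i < G.dist u b
  have : Std.Symm rel := ⟨fun a b h => ⟨h.1.symm, h.2.2, h.2.1⟩⟩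
  have hsymm : ∀ a b, ReflTransGen rel a b → ReflTransGen rel b a :=
    (ReflTransGen.stdSymm (r := rel)).symm
  -- `R` is the component of `v` inside the last level. A neighbor outside `R` lies on level `i`,
  -- hence sees all of `R`.
  let R : Finset V := Finset.univ.filter (ReflTransGen rel v)
  have hR : ∀ z, z ∈ R ↔ ReflTransGen rel v z := by simp [R]
  have hlev : ∀ z ∈ R, G.dist u z = i + 1 := by
    intro z hz
    rw [hR] at hz
    have := hmax z
    induction hz with
    | refl => exact hv
    | tail _ h _ => have := h.2.2; omega
  have hlow : ∀ t, G.Reachable u t → G.dist u t = i → ∀ x ∈ R, ∀ y ∈ R, G.Adj t x →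
      G.Adj t y := by
    intro t hut ht x hx y hy htx
    refine hG.adj_of_reflTransGen hut ht htx (hlev x hx) (hlev y hy) ?_
    exact ReflTransGen.mono (fun a b h => ⟨h.1, h.2.2⟩) _ _
      ((hsymm _ _ ((hR x).1 hx)).trans ((hR y).1 hy))
  have hvR : v ∈ R := (hR v).2 ReflTransGen.refl
  have hwR : w ∈ R := (hR w).2 (ReflTransGen.single ⟨hvw, by omega, by omega⟩)
  obtain ⟨t, htv, ht, hut⟩ := exists_adj_dist_eq hv
  refine hG.exists_twins_of_homogeneous (M := R) (h := t)
    (Finset.one_lt_card.2 ⟨v, hvR, w, hwR, hvw.ne⟩) (fun x hx => hlow t hut ht v hvR x hx htv) ?_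
  intro z hz x hx y hy hzx
  have hx' := hlev x hx
  have hux : G.Reachable u x := Reachable.of_dist_ne_zero (by omega)
  have hz' : ¬ i < G.dist u z := fun h =>
    hz ((hR z).2 (((hR x).1 hx).tail ⟨hzx.symm, by omega, h⟩))
  have hzi : G.dist u z = i := by
    rcases hzx.diff_dist_adj (u := u) with h | h | h <;> omega
  exact hlow z (hux.trans hzx.symm.reachable) hzi x hx y hy hzx

/-- The case of an independent last distance level: a vertex of that level with the fewest
neighbours has a single neighbour, or its neighbourhood is homogeneous. -/
lemma exists_prunable_of_independent_last_level (hG : IsDistanceHereditary G) {u x₀ : V} {i : ℕ}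
    (hmax : ∀ z, G.dist u z ≤ i + 1) (hx₀ : G.dist u x₀ = i + 1)
    (hind : ∀ v w, G.dist u v = i + 1 → G.dist u w = i + 1 → ¬ G.Adj v w) :
    ∃ v w, v ≠ w ∧ ((∀ z, z ≠ v → z ≠ w → ¬ G.Adj v z) ∨
      ∀ z, z ≠ v → z ≠ w → (G.Adj v z ↔ G.Adj w z)) := by
  classical
  obtain ⟨v, hv, hmin⟩ := Finset.exists_min_image
    (Finset.univ.filter fun z => G.dist u z = i + 1) (fun z => (G.neighborFinset z).card)
    ⟨x₀, by simp [hx₀]⟩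
  simp only [Finset.mem_filter, Finset.mem_univ, true_and] at hv hmin
  have hnbr : ∀ w, G.dist u w = i + 1 → ∀ x, G.Adj w x → G.dist u x = i ∧ G.Reachable u x := by
    intro w hw x hwx
    have huw : G.Reachable u w := Reachable.of_dist_ne_zero (by omega)
    have h1 := hmax x
    have h2 : G.dist u x ≠ i + 1 := fun h => hind w x hw h hwx
    refine ⟨?_, huw.trans hwx.reachable⟩
    rcases hwx.diff_dist_adj (u := u) with h | h | h <;> omega
  obtain ⟨p, hpv, -, -⟩ := exists_adj_dist_eq hv
  by_cases hcard : 2 ≤ (G.neighborFinset v).card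
  swap
  · refine ⟨v, p, hpv.ne', Or.inl fun z _ hzp hvz => hcard ?_⟩
    exact Finset.one_lt_card.2 ⟨z, by simpa using hvz, p, by simpa using hpv.symm, hzp⟩
  have hi : i ≠ 0 := by
    rintro rfl
    obtain ⟨x, hx, y, hy, hxy⟩ := Finset.one_lt_card.1 hcard
    rw [mem_neighborFinset] at hx hy
    obtain ⟨hx1, hx2⟩ := hnbr v hv x hx
    obtain ⟨hy1, hy2⟩ := hnbr v hv y hy
    exact hxy ((hx2.dist_eq_zero_iff.1 hx1).symm.trans (hy2.dist_eq_zero_iff.1 hy1))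
  obtain ⟨j, rfl⟩ := Nat.exists_eq_succ_of_ne_zero hi
  -- neighbours of a last-level vertex agree on the level `j`
  have hup : ∀ w, G.dist u w = j + 1 + 1 → ∀ x y, G.Adj w x → G.Adj w y → ∀ t,
      G.Reachable u t → G.dist u t = j → G.Adj t x → G.Adj t y := by
    intro w hw x y hx hy t hut ht htx
    have hx' := (hnbr w hw x hx).1
    have hy' := (hnbr w hw y hy).1
    exact hG.adj_of_reflTransGen hut ht htx hx' hy'
      ((ReflTransGen.single ⟨hx.symm, by omega⟩).tail ⟨hy, by omega⟩)
  have hfar : ∀ a b, G.dist u a = j → G.Reachable u a → G.dist u b = j + 1 + 1 →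
      a ≠ b ∧ ¬ G.Adj b a := by
    intro a b ha _ hb
    refine ⟨by rintro rfl; omega, fun h => ?_⟩
    have := (hnbr b hb a h).1
    omega
  obtain ⟨a, b, hab, h⟩ := hG.exists_twins_of_homogeneous (M := G.neighborFinset v) (h := v) hcard
    (fun x hx => by simpa using hx) (by
      intro z hz x hx y hy hzx
      rw [mem_neighborFinset] at hz hx hy
      by_contra hzy
      have hzv : z ≠ v := by rintro rfl; exact hzy hy
      have hzy' : z ≠ y := by rintro rfl; exact hz hy
      obtain ⟨hxi, hux⟩ := hnbr v hv x hx
      obtain ⟨hyi, huy⟩ := hnbr v hv y hy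
      have huz : G.Reachable u z := hux.trans hzx.symm.reachable
      obtain ⟨t, htx, ht, hut⟩ := exists_adj_dist_eq hxi
      have hty := hup v hv x y hx hy t hut ht htx
      have htv := hfar t v ht hut hv
      have hlev : G.dist u z = j ∨ G.dist u z = j + 1 ∨ G.dist u z = j + 1 + 1 := by
        rcases hzx.diff_dist_adj (u := u) with h | h | h <;> omega
      rcases hlev with hzl | hzl | hzl
      · exact hzy (hup v hv x y hx hy z huz hzl hzx)
      -- On the level of `x` and `y`: `z` also has `t` as a neighbor. From the root `z`, the
      -- adjacent vertices `y` and `v` are at distance two, so `t` would be adjacent to `v`, two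
      -- levels away.
      · have htz : G.Adj t z := hG.adj_of_reflTransGen hut ht htx hxi hzl
          (ReflTransGen.single ⟨hzx.symm, by omega⟩)
        refine htv.2 (hG.adj_of_common_neighbor_of_adj (r := z) (c := t) (d := x) (x := y) (y := v)
          hzy' hzv hzy (fun h => hz h.symm) htz.symm hty hzx hx.symm hy.symm).symm
      -- On the last level: minimality of the degree of `v` gives a neighbor `b` of `z` that `v`
      -- lacks. From the root `z`, the path `t y v` avoids the closed neighborhood of `z`, so `b`,
      -- adjacent to `t`, is adjacent to `v`.
      · obtain ⟨b, hb, hbv⟩ : ∃ b, G.Adj z b ∧ ¬ G.Adj v b := by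
          by_contra! hcon
          have hss : G.neighborFinset z ⊂ G.neighborFinset v := by
            refine (Finset.ssubset_iff_of_subset fun b hb => ?_).2
              ⟨y, by simpa using hy, by simpa using hzy⟩
            rw [mem_neighborFinset] at hb ⊢
            exact hcon b hb
          exact absurd (hmin z hzl) (not_le.2 (Finset.card_lt_card hss))
        have htz := hfar t z ht hut hzl
        have htb := hup z hzl x b hzx hb t hut ht htx
        exact hbv (hG.adj_of_common_neighbor (r := z) (c := b) (d := x) (x := t) (s := y) (y := v)
          htz.1.symm hzv htz.2 (hind z v hzl hv) hzy' hzy hb htb.symm hzx hx.symm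
          hty hy.symm).symm)
  exact ⟨a, b, hab, Or.inr h⟩

/-- Every distance-hereditary graph with at least two vertices has a vertex of degree at most one
or a pair of twins. -/
theorem exists_prunable (hG : IsDistanceHereditary G) [Nontrivial V] :
    ∃ v w, v ≠ w ∧ ((∀ z, z ≠ v → z ≠ w → ¬ G.Adj v z) ∨
      ∀ z, z ≠ v → z ≠ w → (G.Adj v z ↔ G.Adj w z)) := by
  obtain ⟨u, u', huu'⟩ := exists_pair_ne V
  obtain ⟨x₀, -, hmax⟩ := Finset.exists_max_image Finset.univ (G.dist u) ⟨u, Finset.mem_univ u⟩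
  simp only [Finset.mem_univ, forall_const] at hmax
  -- Unreachable vertices have `dist` equal to `0`, so a zero maximum means that `u` is isolated,
  -- and positive levels lie in the component of `u`.
  cases hd : G.dist u x₀ with
  | zero =>
    refine ⟨u, u', huu', Or.inl fun z _ _ h => ?_⟩
    have h1 := dist_eq_one_iff_adj.2 h
    have h2 := hmax z
    omega
  | succ i =>
    rw [hd] at hmax
    by_cases hind : ∀ v w, G.dist u v = i + 1 → G.dist u w = i + 1 → ¬ G.Adj v w
    · exact hG.exists_prunable_of_independent_last_level hmax hd hind
    · push Not at hind
      obtain ⟨v, w, hv, hw, hvw⟩ := hind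
      obtain ⟨a, b, hab, h⟩ := hG.exists_twins_of_adj_last_level hmax hv hw hvw
      exact ⟨a, b, hab, Or.inr h⟩

end IsDistanceHereditary

/-! ### Counting restrictions of distance-hereditary graphs -/

namespace SimpleGraph

variable {V : Type*}

/-- The graph obtained from `G` by deleting all edges that are not inside `D`. -/
def restrictTo (D : Finset V) (G : SimpleGraph V) : SimpleGraph V where
  Adj x y := x ∈ D ∧ y ∈ D ∧ G.Adj x y
  symm := ⟨fun _ _ h => ⟨h.2.1, h.1, h.2.2.symm⟩⟩
  loopless := ⟨fun _ h => h.2.2.ne rfl⟩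

lemma restrictTo_adj {D : Finset V} {G : SimpleGraph V} {x y : V} :
    (restrictTo D G).Adj x y ↔ x ∈ D ∧ y ∈ D ∧ G.Adj x y := Iff.rfl

end SimpleGraph

open SimpleGraph

lemma IsDistanceHereditary.exists_prunable_mem {V : Type*} {G : SimpleGraph V}
    (hG : IsDistanceHereditary G) {D : Finset V} (hD : 2 ≤ D.card) :
    ∃ v ∈ D, ∃ w ∈ D, v ≠ w ∧ ((∀ z ∈ D, z ≠ v → z ≠ w → ¬ G.Adj v z) ∨
      ∀ z ∈ D, z ≠ v → z ≠ w → (G.Adj v z ↔ G.Adj w z)) := by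
  have hnt : Nontrivial (D : Set V) := by
    obtain ⟨a, ha, b, hb, hab⟩ := Finset.one_lt_card.1 hD
    exact ⟨⟨a, ha⟩, ⟨b, hb⟩, by simpa using hab⟩
  have : Fintype (D : Set V) := inferInstanceAs (Fintype D)
  obtain ⟨v, w, hvw, h⟩ := (hG.induce (D : Set V)).exists_prunable
  refine ⟨v, v.2, w, w.2, fun h => hvw (Subtype.ext h), ?_⟩
  refine h.imp (fun h z hz h1 h2 => ?_) (fun h z hz h1 h2 => ?_)
  · simpa using h ⟨z, hz⟩ (fun e => h1 (congrArg Subtype.val e))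
      (fun e => h2 (congrArg Subtype.val e))
  · simpa using h ⟨z, hz⟩ (fun e => h1 (congrArg Subtype.val e))
      (fun e => h2 (congrArg Subtype.val e))

open Classical in
/-- Distance-hereditary graphs on `n` vertices have at most `(4 n²) ^ |D|` restrictions to `D`. -/
theorem card_image_restrictTo_le {V : Type*} [Fintype V] (D : Finset V) :
    ((Finset.univ.filter fun G : SimpleGraph V => IsDistanceHereditary G).image
      (restrictTo D)).card ≤ (4 * Fintype.card V ^ 2) ^ D.card := by
  induction D using Finset.strongInduction with
  | H D ih =>
    by_cases hD : 2 ≤ D.card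
    swap
    · have hle : D.card ≤ 1 := by omega
      have hsub : ((Finset.univ.filter fun G : SimpleGraph V => IsDistanceHereditary G).image
          (restrictTo D)) ⊆ {⊥} := by
        intro K hK
        obtain ⟨G, -, rfl⟩ := Finset.mem_image.1 hK
        rw [Finset.mem_singleton]
        ext x y
        simp only [restrictTo_adj, bot_adj, iff_false]
        rintro ⟨hx, hy, h⟩
        exact h.ne (Finset.card_le_one.1 hle x hx y hy)
      refine (Finset.card_le_card hsub).trans ?_
      rcases isEmpty_or_nonempty V with h | h
      · have : D = ∅ := Finset.eq_empty_of_isEmpty D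
        simp [this]
      · rw [Finset.card_singleton]
        have : 0 < Fintype.card V := Fintype.card_pos
        exact Nat.one_le_pow _ _ (by positivity)
    let DH := Finset.univ.filter fun G : SimpleGraph V => IsDistanceHereditary G
    -- A code `(v, w, b, c)` describes a pruning step: `b` tells whether `v` and `w` are adjacent,
    -- `c` whether `v` copies `w` elsewhere or has no other neighbors. With the code known, deleting
    -- `v` loses no information; there are `4 n²` codes.
    let P : (V × V × Bool × Bool) → SimpleGraph V → Prop := fun τ K =>
      τ.1 ∈ D ∧ τ.1 ≠ τ.2.1 ∧ (K.Adj τ.1 τ.2.1 ↔ τ.2.2.1 = true) ∧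
        ∀ z ∈ D, z ≠ τ.1 → z ≠ τ.2.1 → (K.Adj τ.1 z ↔ (τ.2.2.2 = true ∧ K.Adj τ.2.1 z))
    have hcover : DH.image (restrictTo D) ⊆ (Finset.univ : Finset (V × V × Bool × Bool)).biUnion
        fun τ => (DH.image (restrictTo D)).filter (P τ) := by
      intro K hK
      simp only [Finset.mem_biUnion, Finset.mem_univ, true_and, Finset.mem_filter]
      obtain ⟨G, hG, rfl⟩ := Finset.mem_image.1 hK
      obtain ⟨v, hv, w, hw, hvw, h⟩ := (Finset.mem_filter.1 hG).2.exists_prunable_mem hD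
      rcases h with h | h
      · refine ⟨(v, w, decide (G.Adj v w), false), hK, hv, hvw, by simp [restrictTo_adj, hv, hw], ?_⟩
        intro z hz h1 h2
        simp [restrictTo_adj, h z hz h1 h2]
      · refine ⟨(v, w, decide (G.Adj v w), true), hK, hv, hvw, by simp [restrictTo_adj, hv, hw], ?_⟩
        intro z hz h1 h2
        simp [restrictTo_adj, h z hz h1 h2, hv, hw]
    have hbound : ∀ τ ∈ (Finset.univ : Finset (V × V × Bool × Bool)),
        ((DH.image (restrictTo D)).filter (P τ)).card ≤
          (4 * Fintype.card V ^ 2) ^ (D.card - 1) := by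
      rintro ⟨v, w, b, c⟩ -
      by_cases hv : v ∈ D
      swap
      · rw [Finset.filter_false_of_mem (fun K _ hK => hv hK.1)]
        simp
      refine le_trans ?_ ((ih (D.erase v) (Finset.erase_ssubset hv)).trans_eq
        (by rw [Finset.card_erase_of_mem hv]))
      refine Finset.card_le_card_of_injOn (restrictTo (D.erase v)) ?_ ?_
      · intro K hK
        obtain ⟨G, hG, rfl⟩ := Finset.mem_image.1 (Finset.mem_filter.1 hK).1
        refine Finset.mem_coe.2 (Finset.mem_image.2 ⟨G, hG, ?_⟩)
        ext x y
        simp only [restrictTo_adj, Finset.mem_erase]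
        tauto
      · intro K hK K' hK' he
        obtain ⟨hK1, -, hvw, hK2, hK3⟩ := Finset.mem_filter.1 hK
        obtain ⟨hK1', -, -, hK2', hK3'⟩ := Finset.mem_filter.1 hK'
        have hin : ∀ L ∈ DH.image (restrictTo D), ∀ x y, L.Adj x y → x ∈ D ∧ y ∈ D := by
          intro L hL x y hxy
          obtain ⟨G, -, rfl⟩ := Finset.mem_image.1 hL
          exact ⟨hxy.1, hxy.2.1⟩
        have hoff : ∀ x y, x ≠ v → y ≠ v → (K.Adj x y ↔ K'.Adj x y) := by
          intro x y hx hy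
          have h : (restrictTo (D.erase v) K).Adj x y ↔ (restrictTo (D.erase v) K').Adj x y := by
            rw [he]
          have hmem : ∀ L ∈ DH.image (restrictTo D), L.Adj x y → (restrictTo (D.erase v) L).Adj x y :=
            fun L hL hxy => ⟨Finset.mem_erase.2 ⟨hx, (hin L hL x y hxy).1⟩,
              Finset.mem_erase.2 ⟨hy, (hin L hL x y hxy).2⟩, hxy⟩
          exact ⟨fun hk => (h.1 (hmem K hK1 hk)).2.2, fun hk => (h.2 (hmem K' hK1' hk)).2.2⟩
        have hat : ∀ z, K.Adj v z ↔ K'.Adj v z := by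
          intro z
          by_cases hz : z ∈ D
          · by_cases hzv : z = v
            · subst hzv; simp
            by_cases hzw : z = w
            · subst hzw; exact hK2.trans hK2'.symm
            rw [hK3 z hz hzv hzw, hK3' z hz hzv hzw, hoff w z (Ne.symm hvw) hzv]
          · exact ⟨fun h => absurd (hin K hK1 v z h).2 hz, fun h => absurd (hin K' hK1' v z h).2 hz⟩
        ext x y
        by_cases hx : x = v
        · subst hx; exact hat y
        by_cases hy : y = v
        · subst hy; rw [K.adj_comm, K'.adj_comm]; exact hat x
        exact hoff x y hx hy
    refine (Finset.card_le_card hcover).trans ((Finset.card_biUnion_le_card_mul _ _ _ hbound).trans ?_)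
    obtain ⟨m, hm⟩ : ∃ m, D.card = m + 1 := ⟨D.card - 1, by omega⟩
    rw [hm, Nat.add_sub_cancel, pow_succ]
    simp only [Finset.card_univ, Fintype.card_prod, Fintype.card_bool]
    apply le_of_eq
    ring

/-! ### Measuring almost orthogonal states -/

/-- A Bessel inequality for almost orthogonal families. -/
lemma sum_norm_inner_sq_le {E ι : Type*} [NormedAddCommGroup E] [InnerProductSpace ℂ E]
    (s : Finset ι) (ψ : ι → E) {K : ℝ} (hK : 0 ≤ K)
    (h : ∀ i ∈ s, ∑ j ∈ s, ‖inner ℂ (ψ i) (ψ j)‖ ≤ K) (φ : E) :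
    ∑ i ∈ s, ‖inner ℂ (ψ i) φ‖ ^ 2 ≤ K * ‖φ‖ ^ 2 := by
  set c : ι → ℂ := fun i => inner ℂ (ψ i) φ with hc
  set S : ℝ := ∑ i ∈ s, ‖c i‖ ^ 2 with hS
  set v : E := ∑ i ∈ s, c i • ψ i with hv
  have hS0 : 0 ≤ S := Finset.sum_nonneg fun _ _ => by positivity
  have hvφ : inner ℂ v φ = (S : ℂ) := by
    rw [hv, sum_inner, hS]
    push_cast
    refine Finset.sum_congr rfl fun i _ => ?_
    rw [inner_smul_left]
    exact Complex.conj_mul' (c i)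
  -- Schur's test: `|c i| |c j|` is bounded by the mean of the squares and the row sums of the Gram
  -- matrix by `K`. Cauchy–Schwarz for `⟨v, φ⟩ = S` then finishes.
  have hvv : ‖v‖ ^ 2 ≤ K * S := by
    have h1 : ‖v‖ ^ 2 ≤ ∑ i ∈ s, ∑ j ∈ s, ‖c i‖ * ‖c j‖ * ‖inner ℂ (ψ i) (ψ j)‖ := by
      have : ‖v‖ ^ 2 = ‖inner ℂ v v‖ := by
        rw [inner_self_eq_norm_sq_to_K]; simp
      rw [this, hv, sum_inner]
      refine (norm_sum_le _ _).trans (Finset.sum_le_sum fun i _ => ?_)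
      rw [inner_sum]
      refine (norm_sum_le _ _).trans (Finset.sum_le_sum fun j _ => ?_)
      rw [inner_smul_left, inner_smul_right, norm_mul, norm_mul, RCLike.norm_conj, mul_assoc]
    have h2 : ∑ i ∈ s, ∑ j ∈ s, ‖c i‖ * ‖c j‖ * ‖inner ℂ (ψ i) (ψ j)‖ ≤
        ∑ i ∈ s, ∑ j ∈ s, (‖c i‖ ^ 2 / 2 * ‖inner ℂ (ψ i) (ψ j)‖ +
          ‖c j‖ ^ 2 / 2 * ‖inner ℂ (ψ i) (ψ j)‖) := by
      refine Finset.sum_le_sum fun i _ => Finset.sum_le_sum fun j _ => ?_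
      rw [← add_mul]
      refine mul_le_mul_of_nonneg_right ?_ (norm_nonneg _)
      nlinarith [sq_nonneg (‖c i‖ - ‖c j‖)]
    have h3 : ∑ i ∈ s, ∑ j ∈ s, ‖c i‖ ^ 2 / 2 * ‖inner ℂ (ψ i) (ψ j)‖ ≤ K * S / 2 := by
      rw [hS, Finset.mul_sum, Finset.sum_div]
      refine Finset.sum_le_sum fun i hi => ?_
      rw [← Finset.mul_sum]
      have := mul_le_mul_of_nonneg_left (h i hi) (show 0 ≤ ‖c i‖ ^ 2 / 2 by positivity)
      linarith
    have h4 : ∑ i ∈ s, ∑ j ∈ s, ‖c j‖ ^ 2 / 2 * ‖inner ℂ (ψ i) (ψ j)‖ =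
        ∑ i ∈ s, ∑ j ∈ s, ‖c i‖ ^ 2 / 2 * ‖inner ℂ (ψ i) (ψ j)‖ := by
      rw [Finset.sum_comm]
      refine Finset.sum_congr rfl fun i _ => Finset.sum_congr rfl fun j _ => ?_
      rw [norm_inner_symm (ψ j) (ψ i)]
    simp only [Finset.sum_add_distrib] at h2
    linarith
  have hcs : S ≤ ‖v‖ * ‖φ‖ := by
    have := norm_inner_le_norm (𝕜 := ℂ) v φ
    rwa [hvφ, Complex.norm_real, Real.norm_of_nonneg hS0] at this
  rcases hS0.eq_or_lt with h0 | h0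
  · rw [← h0]; positivity
  · have h5 : S * S ≤ K * ‖φ‖ ^ 2 * S := by
      calc S * S ≤ (‖v‖ * ‖φ‖) * (‖v‖ * ‖φ‖) := mul_self_le_mul_self hS0 hcs
        _ = ‖v‖ ^ 2 * ‖φ‖ ^ 2 := by ring
        _ ≤ K * S * ‖φ‖ ^ 2 := mul_le_mul_of_nonneg_right hvv (by positivity)
        _ = K * ‖φ‖ ^ 2 * S := by ring
    exact le_of_mul_le_mul_right h5 h0

lemma dotProduct_vecMulVec_star_mulVec {B : Type*} [Fintype B] (ψ φ : B → ℂ) :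
    star φ ⬝ᵥ (Matrix.vecMulVec ψ (star ψ) *ᵥ φ) = ((‖star ψ ⬝ᵥ φ‖ ^ 2 : ℝ) : ℂ) := by
  rw [Matrix.vecMulVec_mulVec, dotProduct_smul, op_smul_eq_mul]
  have : star φ ⬝ᵥ ψ = star (star ψ ⬝ᵥ φ) := by
    rw [← Matrix.star_dotProduct_star, star_star, dotProduct_comm]
  rw [this]
  push_cast
  exact Complex.conj_mul' _

open Classical in
/-- A family of unit vectors with small overlaps can be identified by a measurement, which rejects
every vector that has small overlaps with the family. -/
lemma exists_measurement {B Γ : Type} [Fintype B] [DecidableEq B] [Fintype Γ] (s : Finset Γ)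
    (ψ : Γ → B → ℂ) (hunit : ∀ i, star (ψ i) ⬝ᵥ ψ i = 1)
    (hover : ∀ i, ∑ j ∈ s.erase i, ‖star (ψ j) ⬝ᵥ ψ i‖ ≤ 1 / 3) :
    ∃ M : Measurement B (Option Γ), (∀ i ∈ s, 2 / 3 ≤ M.prob (ψ i) (some i)) ∧
      ∀ i ∉ s, 2 / 3 ≤ M.prob (ψ i) none := by
  let T : Γ → Matrix B B ℂ := fun i => Matrix.vecMulVec (ψ i) (star (ψ i))
  have hT : ∀ i, (T i).PosSemidef := fun i => Matrix.posSemidef_vecMulVec_self_star (ψ i)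
  -- The Gram row sums are at most `1 + 1/3`, so `3/4` is a scale at which the projections sum to at
  -- most the identity.
  let c : ℂ := ((3 / 4 : ℝ) : ℂ)
  have hc : (0 : ℂ) ≤ c := by simp only [c]; exact_mod_cast (by norm_num : (0 : ℝ) ≤ 3 / 4)
  have hsymm : ∀ i j, ‖star (ψ j) ⬝ᵥ ψ i‖ = ‖star (ψ i) ⬝ᵥ ψ j‖ := by
    intro i j
    rw [← norm_star, ← Matrix.star_dotProduct_star, star_star, dotProduct_comm]
  have hbessel : ∀ φ : B → ℂ, ∑ i ∈ s, ‖star (ψ i) ⬝ᵥ φ‖ ^ 2 ≤ 4 / 3 * (star φ ⬝ᵥ φ).re := by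
    intro φ
    have hin : ∀ x y : B → ℂ, inner ℂ (WithLp.toLp 2 x) (WithLp.toLp 2 y) = star x ⬝ᵥ y := by
      intro x y
      rw [EuclideanSpace.inner_toLp_toLp, dotProduct_comm]
    have h := sum_norm_inner_sq_le s (fun i => WithLp.toLp 2 (ψ i)) (K := 4 / 3) (by norm_num)
      (by
        intro i hi
        simp only [hin]
        rw [← Finset.add_sum_erase s _ hi, hunit]
        have h1 := hover i
        have h2 : ∑ j ∈ s.erase i, ‖star (ψ i) ⬝ᵥ ψ j‖ = ∑ j ∈ s.erase i, ‖star (ψ j) ⬝ᵥ ψ i‖ :=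
          Finset.sum_congr rfl fun j _ => hsymm j i
        rw [h2, norm_one]
        linarith) (WithLp.toLp 2 φ)
    simp only [hin] at h
    have h3 : ‖WithLp.toLp 2 φ‖ ^ 2 = (star φ ⬝ᵥ φ).re := by
      rw [← hin, inner_self_eq_norm_sq_to_K]
      norm_cast
    rwa [h3] at h
  have hnone : ∀ φ : B → ℂ, star φ ⬝ᵥ ((1 - ∑ i ∈ s, c • T i) *ᵥ φ) =
      star φ ⬝ᵥ φ - ((3 / 4 * ∑ i ∈ s, ‖star (ψ i) ⬝ᵥ φ‖ ^ 2 : ℝ) : ℂ) := by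
    intro φ
    rw [Matrix.sub_mulVec, Matrix.one_mulVec, dotProduct_sub, Matrix.sum_mulVec, dotProduct_sum]
    congr 1
    rw [Finset.mul_sum, Complex.ofReal_sum]
    refine Finset.sum_congr rfl fun i _ => ?_
    rw [Matrix.smul_mulVec, dotProduct_smul, dotProduct_vecMulVec_star_mulVec, smul_eq_mul,
      Complex.ofReal_mul]
  have hreal : ∀ φ : B → ℂ, star φ ⬝ᵥ φ = ((star φ ⬝ᵥ φ).re : ℂ) := fun φ =>
    Complex.eq_re_of_ofReal_le (r := 0) (by simp)
  refine ⟨{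
    effect := fun o => o.elim (1 - ∑ i ∈ s, c • T i) fun i => if i ∈ s then c • T i else 0
    posSemidef := ?_
    sum_effect := ?_ }, ?_, ?_⟩
  · rintro (_ | i)
    · refine Matrix.PosSemidef.of_dotProduct_mulVec_nonneg ?_ fun φ => ?_
      · exact Matrix.isHermitian_one.sub
          (Matrix.posSemidef_sum s fun i _ => (hT i).smul hc).isHermitian
      · have h1 := hbessel φ
        simp only [Option.elim]
        rw [hnone, hreal, ← Complex.ofReal_sub]
        exact_mod_cast (by linarith)
    · simp only [Option.elim]
      split_ifs
      · exact (hT i).smul hc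
      · exact Matrix.PosSemidef.zero
  · rw [Fintype.sum_option]
    simp [Finset.sum_ite_mem]
  · intro i hi
    simp only [Measurement.prob, Option.elim, hi, if_true]
    rw [Matrix.smul_mulVec, dotProduct_smul, dotProduct_vecMulVec_star_mulVec, hunit, norm_one,
      smul_eq_mul, ← Complex.ofReal_mul, Complex.ofReal_re]
    norm_num
  · intro i hi
    simp only [Measurement.prob, Option.elim]
    rw [hnone, hunit, Complex.sub_re, Complex.ofReal_re, Complex.one_re]
    have h1 := hover i
    rw [Finset.erase_eq_of_notMem hi] at h1
    -- Overlaps are at most one, so squaring only decreases them, and rejection has probability at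
    -- least `1 - 3/4 * 1/3 = 3/4`.
    have h2 : ∑ j ∈ s, ‖star (ψ j) ⬝ᵥ ψ i‖ ^ 2 ≤ ∑ j ∈ s, ‖star (ψ j) ⬝ᵥ ψ i‖ := by
      refine Finset.sum_le_sum fun j hj => ?_
      have h3 : ‖star (ψ j) ⬝ᵥ ψ i‖ ≤ 1 / 3 :=
        (Finset.single_le_sum (f := fun j => ‖star (ψ j) ⬝ᵥ ψ i‖)
          (fun _ _ => norm_nonneg _) hj).trans h1
      nlinarith [norm_nonneg (star (ψ j) ⬝ᵥ ψ i)]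
    linarith

/-! ### Product states and polynomial fingerprints -/

/-- Overlaps of product states are products of overlaps. -/
lemma star_prod_dotProduct_prod {k : ℕ} {B : Fin k → Type} [∀ v, Fintype (B v)]
    (f g : ∀ v, B v → ℂ) :
    star (fun b : ∀ v, B v => ∏ v, f v (b v)) ⬝ᵥ (fun b => ∏ v, g v (b v)) =
      ∏ v, star (f v) ⬝ᵥ g v := by
  simp only [dotProduct, Pi.star_apply, star_prod, ← Finset.prod_mul_distrib]
  rw [Finset.prod_univ_sum, Fintype.piFinset_univ]

lemma PureState.star_dotProduct_self {B : Type} [Fintype B] (ψ : PureState B) :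
    star ψ.amp ⬝ᵥ ψ.amp = 1 := by
  have h := ψ.norm_one
  simp only [dotProduct, Pi.star_apply]
  rw [← Complex.ofReal_one, ← h, Complex.ofReal_sum]
  refine Finset.sum_congr rfl fun b _ => ?_
  push_cast
  exact Complex.conj_mul' _

/-- Distinct polynomials with coefficients in `{0, 1}` and degree less than `k` agree on at most
`k` points. -/
lemma card_filter_sum_eq_le {F : Type*} [Field F] [Fintype F] [DecidableEq F] [Algebra (ZMod 2) F]
    {k : ℕ} {x y : Fin k → ZMod 2} (hxy : x ≠ y) :
    (Finset.univ.filter fun a : F => ∑ u, algebraMap (ZMod 2) F (x u) * a ^ (u : ℕ) =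
      ∑ u, algebraMap (ZMod 2) F (y u) * a ^ (u : ℕ)).card ≤ k := by
  let q : Polynomial F :=
    ∑ u : Fin k, Polynomial.monomial (u : ℕ) (algebraMap (ZMod 2) F (x u - y u))
  have hcoeff : ∀ w : Fin k, q.coeff w = algebraMap (ZMod 2) F (x w - y w) := by
    intro w
    simp only [q, Polynomial.finsetSum_coeff, Polynomial.coeff_monomial]
    rw [Finset.sum_eq_single w]
    · simp
    · intro b _ hb
      rw [if_neg (fun h => hb (Fin.ext h))]
    · simp
  have hq : q ≠ 0 := by
    intro h0
    obtain ⟨w, hw⟩ := Function.ne_iff.1 hxy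
    have := hcoeff w
    rw [h0, Polynomial.coeff_zero, eq_comm, map_eq_zero, sub_eq_zero] at this
    exact hw this
  have hdeg : q.natDegree ≤ k := by
    refine Polynomial.natDegree_sum_le_of_forall_le _ _ fun u _ => ?_
    exact (Polynomial.natDegree_monomial_le _).trans u.2.le
  refine (Polynomial.card_le_degree_of_subset_roots (p := q) ?_).trans hdeg
  intro a ha
  rw [Finset.mem_val, Finset.mem_filter] at ha
  rw [Polynomial.mem_roots hq, Polynomial.IsRoot.def]
  simp only [q, Polynomial.eval_finsetSum, Polynomial.eval_monomial]
  simp only [map_sub, sub_mul, Finset.sum_sub_distrib]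
  rw [ha.2, sub_self]

/-- Quantum fingerprints of `2 n` qubits whose pairwise overlaps are at most `k / 2 ^ n`. -/
lemma exists_fingerprint (k : ℕ) {n : ℕ} (hn : n ≠ 0) :
    ∃ m : (Fin k → ZMod 2) → PureState (QubitBasis (2 * n)),
      ∀ x y, x ≠ y → ‖star (m x).amp ⬝ᵥ (m y).amp‖ ≤ k / 2 ^ n := by
  classical
  let F := GaloisField 2 n
  have : Fintype F := Fintype.ofFinite F
  have hF : Fintype.card F = 2 ^ n := by
    rw [← Nat.card_eq_fintype_card]; exact GaloisField.card 2 n hn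
  let e : QubitBasis (2 * n) ≃ F × F := Fintype.equivOfCardEq (by
    simp [hF, ← pow_add, two_mul])
  let p : (Fin k → ZMod 2) → F → F := fun x a => ∑ u, algebraMap (ZMod 2) F (x u) * a ^ (u : ℕ)
  -- The fingerprint of `x` is the uniform superposition over the graph of the polynomial `p x` on
  -- the field with `2 ^ n` elements; an overlap is the fraction of points where two polynomials
  -- agree.
  let A : (Fin k → ZMod 2) → QubitBasis (2 * n) → ℝ := fun x b =>
    if p x (e b).1 = (e b).2 then (√(2 ^ n))⁻¹ else 0
  have hA : ∀ x y, ∑ b, A x b * A y b =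
      (Finset.univ.filter fun a => p x a = p y a).card / 2 ^ n := by
    intro x y
    rw [e.sum_comp (fun ac : F × F => (if p x ac.1 = ac.2 then (√(2 ^ n))⁻¹ else 0) *
      (if p y ac.1 = ac.2 then (√(2 ^ n))⁻¹ else 0)), Fintype.sum_prod_type, Finset.card_filter]
    push_cast
    rw [Finset.sum_div]
    refine Finset.sum_congr rfl fun a _ => ?_
    have hs : (√(2 ^ n))⁻¹ * (√(2 ^ n))⁻¹ = (1 : ℝ) / 2 ^ n := by
      rw [← mul_inv, Real.mul_self_sqrt (by positivity), one_div]
    rw [Finset.sum_eq_single (p x a)]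
    · by_cases h : p x a = p y a
      · simp only [h, if_true, hs]
      · simp [h, Ne.symm h]
    · intro c _ hc
      simp [Ne.symm hc]
    · simp
  refine ⟨fun x => ⟨fun b => (A x b : ℂ), ?_⟩, fun x y hxy => ?_⟩
  · have h := hA x x
    simp only [Finset.filter_true, Finset.card_univ, hF] at h
    simp only [Complex.norm_real, Real.norm_eq_abs, sq_abs]
    simp only [sq]
    rw [h]
    push_cast
    exact div_self (by positivity)
  · have h : star (fun b => (A x b : ℂ)) ⬝ᵥ (fun b => (A y b : ℂ)) =
        ((∑ b, A x b * A y b : ℝ) : ℂ) := by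
      simp only [dotProduct, Pi.star_apply]
      push_cast
      refine Finset.sum_congr rfl fun b _ => ?_
      rw [← Complex.conj_ofReal (A x b)]
      simp
    change ‖star (fun b => (A x b : ℂ)) ⬝ᵥ (fun b => (A y b : ℂ))‖ ≤ _
    rw [h, Complex.norm_real, hA, Real.norm_of_nonneg (by positivity)]
    gcongr
    exact card_filter_sum_eq_le hxy

/-! ### Total overlap and the protocol -/

open Classical in
/-- Distance-hereditary graphs other than `H`, weighted by `δ` to the number of vertices whose
neighbourhoods differ from those in `H`, have small total weight. -/
lemma sum_pow_card_neighbor_ne_le {V : Type*} [Fintype V] {δ : ℝ} (hδ : 0 ≤ δ)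
    (hδV : 4 * (Fintype.card V : ℝ) ^ 3 * δ ≤ 1 / 4) (H : SimpleGraph V) :
    ∑ G ∈ (Finset.univ.filter fun G : SimpleGraph V => IsDistanceHereditary G).erase H,
      δ ^ (Finset.univ.filter fun v => G.Adj v ≠ H.Adj v).card ≤ 1 / 3 := by
  set N := Fintype.card V with hN
  set DH := Finset.univ.filter fun G : SimpleGraph V => IsDistanceHereditary G
  let diff : SimpleGraph V → Finset V := fun G => Finset.univ.filter fun v => G.Adj v ≠ H.Adj v
  have hmem : ∀ (G : SimpleGraph V) v, v ∉ diff G → G.Adj v = H.Adj v := by simp [diff]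
  have hmaps : ∀ G ∈ DH.erase H, diff G ∈ (Finset.univ : Finset (Finset V)).erase ∅ := by
    intro G hG
    refine Finset.mem_erase.2 ⟨fun h0 => (Finset.mem_erase.1 hG).1 ?_, Finset.mem_univ _⟩
    ext x y
    rw [hmem G x (by rw [h0]; simp)]
  have hfiber : ∀ D : Finset V, ((DH.erase H).filter fun G => diff G = D).card ≤
      (4 * N ^ 2) ^ D.card := by
    intro D
    refine le_trans ?_ (card_image_restrictTo_le D)
    refine Finset.card_le_card_of_injOn (SimpleGraph.restrictTo D) ?_ ?_
    · intro G hG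
      have hG' := (Finset.mem_erase.1 (Finset.mem_filter.1 hG).1).2
      exact Finset.mem_coe.2 (Finset.mem_image_of_mem _ hG')
    · intro G hG G' hG' he
      have hG1 := (Finset.mem_filter.1 hG).2
      have hG2 := (Finset.mem_filter.1 hG').2
      have hoff : ∀ x ∉ D, ∀ y, G.Adj x y ↔ G'.Adj x y := by
        intro x hx y
        rw [hmem G x (by rwa [hG1]), hmem G' x (by rwa [hG2])]
      ext x y
      by_cases hx : x ∈ D
      · by_cases hy : y ∈ D
        · have h : (SimpleGraph.restrictTo D G).Adj x y ↔ (SimpleGraph.restrictTo D G').Adj x y := by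
            rw [he]
          simpa [SimpleGraph.restrictTo_adj, hx, hy] using h
        · rw [G.adj_comm, G'.adj_comm]; exact hoff y hy x
      · exact hoff x hx y
  set c : ℝ := 4 * (N : ℝ) ^ 2 * δ with hc
  have hc0 : 0 ≤ c := by positivity
  have hsum : ∑ G ∈ DH.erase H, δ ^ (diff G).card ≤
      ∑ D ∈ (Finset.univ : Finset (Finset V)).erase ∅, c ^ D.card := by
    rw [← Finset.sum_fiberwise_of_maps_to hmaps]
    refine Finset.sum_le_sum fun D _ => ?_
    rw [Finset.sum_congr rfl (g := fun _ => δ ^ D.card)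
      (fun G hG => by rw [(Finset.mem_filter.1 hG).2]), Finset.sum_const, nsmul_eq_mul, hc, mul_pow]
    refine mul_le_mul_of_nonneg_right ?_ (by positivity)
    exact_mod_cast hfiber D
  have hall : ∑ D : Finset V, c ^ D.card = (c + 1) ^ N := by
    have := Fintype.sum_pow_mul_eq_add_pow V c 1
    simpa using this
  -- `N * c ≤ 1/4`, and `exp (1/4) ≤ 4/3` because `exp (-1/4) ≥ 3/4`. Removing the term `1` of the
  -- empty set leaves `1/3`.
  have hexp : (c + 1) ^ N ≤ 4 / 3 := by
    have h1 : (c + 1) ^ N ≤ Real.exp (1 / 4) := by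
      calc (c + 1) ^ N ≤ Real.exp c ^ N := pow_le_pow_left₀ (by positivity) (Real.add_one_le_exp c) N
        _ = Real.exp (N * c) := (Real.exp_nat_mul c N).symm
        _ ≤ Real.exp (1 / 4) := Real.exp_le_exp.2 (by rw [hc]; linarith)
    have h2 := Real.add_one_le_exp (-(1 / 4) : ℝ)
    have h3 : Real.exp (1 / 4) * Real.exp (-(1 / 4)) = 1 := by rw [← Real.exp_add]; simp
    nlinarith [Real.exp_pos (1 / 4)]
  have hsplit := Finset.add_sum_erase (Finset.univ : Finset (Finset V)) (fun D => c ^ D.card)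
    (Finset.mem_univ ∅)
  simp only [Finset.card_empty, pow_zero] at hsplit
  have : ∑ G ∈ DH.erase H, δ ^ (diff G).card ≤ 1 / 3 := by linarith
  exact this

/-- The joint state of the messages `m` of all players on the graph `G`. -/
noncomputable def graphState {k q : ℕ} (m : (Fin k → ZMod 2) → PureState (QubitBasis q))
    (G : SimpleGraph (Fin k)) : (Fin k → QubitBasis q) → ℂ :=
  fun b => ∏ v, (m (neighborhoodVector G v)).amp (b v)

lemma star_graphState_dotProduct {k q : ℕ} (m : (Fin k → ZMod 2) → PureState (QubitBasis q))
    (G H : SimpleGraph (Fin k)) :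
    star (graphState m G) ⬝ᵥ graphState m H =
      ∏ v, star (m (neighborhoodVector G v)).amp ⬝ᵥ (m (neighborhoodVector H v)).amp :=
  star_prod_dotProduct_prod (fun v => (m (neighborhoodVector G v)).amp)
    (fun v => (m (neighborhoodVector H v)).amp)

open Classical in
/-- Messages for which the states of distance-hereditary graphs have small overlaps give a
protocol. -/
lemma exists_protocol {k q : ℕ} (m : (Fin k → ZMod 2) → PureState (QubitBasis q))
    (hover : ∀ H : SimpleGraph (Fin k),
      ∑ G ∈ (Finset.univ.filter fun G : SimpleGraph (Fin k) => IsDistanceHereditary G).erase H,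
        ‖star (graphState m G) ⬝ᵥ graphState m H‖ ≤ 1 / 3) :
    ∃ P : QuantumSMP k (Fin k → ZMod 2) (Option (SimpleGraph (Fin k))),
      P.cost = k * q ∧ P.SolvesNIH reconstructDistanceHereditary := by
  obtain ⟨M, hM1, hM2⟩ := exists_measurement
    (Finset.univ.filter fun G : SimpleGraph (Fin k) => IsDistanceHereditary G) (graphState m)
    (fun G => by
      rw [star_graphState_dotProduct]
      exact Finset.prod_eq_one fun v _ => PureState.star_dotProduct_self _)
    hover
  refine ⟨⟨fun _ => q, fun _ => m, M⟩, by simp [QuantumSMP.cost], fun G => ?_⟩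
  unfold reconstructDistanceHereditary
  split_ifs with hG
  · exact hM1 G (by simpa using hG)
  · exact hM2 G (by simpa using hG)

lemma neighborhoodVector_eq_iff {k : ℕ} {G H : SimpleGraph (Fin k)} {v : Fin k} :
    neighborhoodVector G v = neighborhoodVector H v ↔ G.Adj v = H.Adj v := by
  constructor
  · intro h
    funext u
    have := congrFun h u
    simp only [neighborhoodVector] at this
    by_cases h1 : G.Adj v u <;> by_cases h2 : H.Adj v u <;> simp_all
  · intro h
    funext u
    have hu : G.Adj v u ↔ H.Adj v u := iff_of_eq (congrFun h u)
    simp only [neighborhoodVector]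
    by_cases h1 : G.Adj v u
    · rw [if_pos h1, if_pos (hu.1 h1)]
    · rw [if_neg h1, if_neg (fun h2 => h1 (hu.2 h2))]

/-- Players with equal neighborhoods contribute a factor `1`, all others at most `δ`. -/
lemma norm_star_graphState_dotProduct_le {k q : ℕ} {δ : ℝ}
    {m : (Fin k → ZMod 2) → PureState (QubitBasis q)}
    (hm : ∀ x y, x ≠ y → ‖star (m x).amp ⬝ᵥ (m y).amp‖ ≤ δ) (G H : SimpleGraph (Fin k))
    [DecidablePred fun v => G.Adj v ≠ H.Adj v] :
    ‖star (graphState m G) ⬝ᵥ graphState m H‖ ≤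
      δ ^ (Finset.univ.filter fun v => G.Adj v ≠ H.Adj v).card := by
  rw [star_graphState_dotProduct, norm_prod, Finset.card_filter, ← Finset.prod_pow_eq_pow_sum]
  refine Finset.prod_le_prod (fun _ _ => norm_nonneg _) fun v _ => ?_
  by_cases h : G.Adj v = H.Adj v
  · rw [neighborhoodVector_eq_iff.2 h, PureState.star_dotProduct_self]
    simp [h]
  · simpa [h] using hm _ _ (fun h' => h (neighborhoodVector_eq_iff.1 h'))

/-- With overlaps polynomially small in `k`, `O(k log k)` qubits suffice. -/
lemma exists_protocol_cost_eq (k l : ℕ) (hlk : k ≤ 2 ^ (l + 1)) :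
    ∃ P : QuantumSMP k (Fin k → ZMod 2) (Option (SimpleGraph (Fin k))),
      P.cost = k * (2 * (4 * l + 8)) ∧ P.SolvesNIH reconstructDistanceHereditary := by
  classical
  -- With `δ = k / 2 ^ n`, the condition `4 k³ δ ≤ 1/4` reads `16 k⁴ ≤ 2 ^ n`, and `16 * (2 ^ (l +
  -- 1)) ^ 4 = 2 ^ (4 l + 8)`.
  obtain ⟨m, hm⟩ := exists_fingerprint k (n := 4 * l + 8) (by omega)
  have hδ : 4 * (k : ℝ) ^ 3 * (k / 2 ^ (4 * l + 8)) ≤ 1 / 4 := by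
    have h1 : (k : ℝ) ^ 4 ≤ (2 ^ (l + 1)) ^ 4 :=
      pow_le_pow_left₀ (by positivity) (by exact_mod_cast hlk) 4
    have h2 : (2 : ℝ) ^ (4 * l + 8) = (2 ^ (l + 1)) ^ 4 * 16 := by
      rw [← pow_mul, show 4 * l + 8 = (l + 1) * 4 + 4 by ring, pow_add]; norm_num
    rw [← mul_div_assoc, div_le_iff₀ (by positivity), h2]
    linarith
  refine exists_protocol m fun H => ?_
  refine le_trans (Finset.sum_le_sum fun G _ => norm_star_graphState_dotProduct_le hm G H) ?_
  have h := sum_pow_card_neighbor_ne_le (V := Fin k) (δ := k / 2 ^ (4 * l + 8)) (by positivity)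
    (by simpa using hδ) H
  refine le_of_eq_of_le ?_ h
  congr!

/-- For `k ≤ 1` the cost bound is zero, so nothing may be sent; there is only one graph. -/
lemma exists_protocol_of_le_one {k : ℕ} (hk : k ≤ 1) :
    ∃ P : QuantumSMP k (Fin k → ZMod 2) (Option (SimpleGraph (Fin k))),
      P.cost = 0 ∧ P.SolvesNIH reconstructDistanceHereditary := by
  classical
  have hsub : ∀ G H : SimpleGraph (Fin k), G = H := by
    have : Subsingleton (Fin k) := Fin.subsingleton_iff_le_one.2 hk
    intro G H; ext x y; simp [Subsingleton.elim x y]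
  exact exists_protocol (k := k) (q := 0) (fun _ => ⟨fun _ => 1, by simp⟩) (fun H => by
    rw [Finset.sum_eq_zero]
    · norm_num
    · intro G hG
      exact absurd (hsub G H) (Finset.mem_erase.1 hG).1)

theorem mainTheorem3 :
    ∃ C : ℝ, ∀ k : ℕ,
      ∃ P : QuantumSMP k (Fin k → ZMod 2) (Option (SimpleGraph (Fin k))),
        (P.cost : ℝ) ≤ C * (k * Real.log k ^ 2) ∧
        P.SolvesNIH reconstructDistanceHereditary := by
  refine ⟨96, fun k => ?_⟩
  by_cases hk : k ≤ 1
  · obtain ⟨P, hcost, hP⟩ := exists_protocol_of_le_one hk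
    refine ⟨P, ?_, hP⟩
    rw [hcost, Nat.cast_zero]
    positivity
  push Not at hk
  obtain ⟨P, hcost, hP⟩ := exists_protocol_cost_eq k (Nat.log 2 k)
    (Nat.lt_pow_succ_log_self (by norm_num) k).le
  refine ⟨P, ?_, hP⟩
  have hlog2 : (1 : ℝ) / 2 ≤ Real.log 2 := by linarith [Real.log_two_gt_d9]
  have hlogk : Real.log 2 ≤ Real.log k := Real.log_le_log (by norm_num) (by exact_mod_cast hk)
  have hpow : 2 ^ Nat.log 2 k ≤ k := Nat.pow_log_le_self 2 (by omega)
  generalize Nat.log 2 k = l at hcost hpow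
  have hle : (l : ℝ) * Real.log 2 ≤ Real.log k := by
    rw [← Real.log_pow]
    exact Real.log_le_log (by positivity) (by exact_mod_cast hpow)
  have hl2 : (l : ℝ) ≤ 2 * Real.log k := by
    nlinarith [mul_le_mul_of_nonneg_left hlog2 (Nat.cast_nonneg (α := ℝ) l)]
  -- Since `l ≤ 2 log k` and `log k ≥ 1/2`, the terms `8 l` and `16` are at most `32 log² k` and `64
  -- log² k`; hence `96`.
  have hbound : (2 * (4 * l + 8) : ℝ) ≤ 96 * Real.log k ^ 2 := by nlinarith
  rw [hcost]
  push_cast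
  calc (k : ℝ) * (2 * (4 * l + 8)) ≤ k * (96 * Real.log k ^ 2) :=
        mul_le_mul_of_nonneg_left hbound (Nat.cast_nonneg k)
    _ = 96 * (k * Real.log k ^ 2) := by ring
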